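/- Let $\mathbb C$ be a (Barr-)exact category: $\mathbb C$ has finite limits, every morphism factors as a regular epimorphism followed by a monomorphism, regular epimorphisms are stable under pullback, and every internal equivalence relation in $\mathbb C$ is the kernel pair of some morphism. Let $\mathsf{PreOrd}(\mathbb C)$ be the category whose objects are the pairs $(A,\rho)$, where $\langle r_1,r_2\rangle\colon\rho\rightarrowtail A\times A$ is a reflexive and transitive internal relation on $A$, and whose morphisms $(A,\rho)\to(B,\sigma)$ are the pairs $(f\colon A\to B,\ \bar f\colon\rho\to\sigma)$ with $s_i\bar f=fr_i$ for $i=1,2$, where $\langle s_1,s_2\rangle\colon\sigma\rightarrowtail B\times B$. Write $\Delta_A=\langle 1_A,1_A\rangle$ and ${\sim_\rho}=\rho\wedge\rho^{o}$, the pullback of $\langle r_1,r_2\rangle$ along $\langle r_2,r_1\rangle$, with projections $p_1,p_2\colon{\sim_\rho}\to A$. Let $\mathsf{Eq}(\mathbb C)$, $\mathsf{ParOrd}(\mathbb C)$ and $\mathsf{Dis}(\mathbb C)$ be the full subcategories of $\mathsf{PreOrd}(\mathbb C)$ of those $(A,\rho)$ for which, respectively, $\rho$ is symmetric, ${\sim_\rho}=\Delta_A$,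 and $\rho=\Delta_A$ (equalities of subobjects of $A\times A$). For a class $\mathcal N$ of morphisms of a category, $k\colon K\to X$ is an $\mathcal N$-kernel of $f\colon X\to Y$ if $fk\in\mathcal N$ and every $l\colon W\to X$ with $fl\in\mathcal N$ factors uniquely as $l=kl'$; $\mathcal N$-cokernels are defined dually; $X\xrightarrow{f}Y\xrightarrow{g}Z$ is short $\mathcal N$-exact if $f$ is an $\mathcal N$-kernel of $g$ and $g$ is an $\mathcal N$-cokernel of $f$. A pair $(\mathcal T,\mathcal F)$ of full replete subcategories is a pretorsion theory if $\mathcal Z=\mathcal T\cap\mathcal F$ (the trivial objects) is non-empty and, for the ideal $\mathcal N$ of the morphisms that factor through an object of $\mathcal Z$: (i) every morphism from an object of $\mathcal T$ to an object of $\mathcal F$ is in $\mathcal N$; (ii) for every object $X$ there is a short $\mathcal N$-exact sequence $T_X\to X\to F_X$ with $T_X\in\mathcal T$ and $F_X\in\mathcal F$. Then: 1. $(\mathsf{Eq}(\mathbb C),\mathsf{ParOrd}(\mathbb C))$ is a pretorsion theory in $\mathsf{PreOrd}(\mathbb C)$. 2. Its trivial objects are the discrete relations: $\mathsf{Eq}(\mathbb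 C)\cap\mathsf{ParOrd}(\mathbb C)=\mathsf{Dis}(\mathbb C)$. 3. For every $(A,\rho)$ in $\mathsf{PreOrd}(\mathbb C)$, $(A,\sim_\rho)$ is in $\mathsf{Eq}(\mathbb C)$; the coequalizer $\pi\colon A\to A/{\sim_\rho}$ of $p_1,p_2$ and the regular image $\pi(\rho)$ of $\rho$ along $\pi$ exist, where $\pi(\rho)$ is given by a factorization $\rho\xrightarrow{\bar\pi}\pi(\rho)\rightarrowtail A/{\sim_\rho}\times A/{\sim_\rho}$ of $\langle\pi r_1,\pi r_2\rangle$ into a regular epimorphism and a monomorphism; for any choice of these, $(A/{\sim_\rho},\pi(\rho))$ is an object of $\mathsf{ParOrd}(\mathbb C)$, and, with $i\colon{\sim_\rho}\to\rho$ the inclusion and $\mathcal N$ the ideal of the morphisms that factor through a discrete relation, $$(A,\sim_\rho)\xrightarrow{(1_A,\,i)}(A,\rho)\xrightarrow{(\pi,\,\bar\pi)}(A/{\sim_\rho},\pi(\rho))$$ is a short $\mathcal N$-exact sequence. -/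

import Mathlib

open CategoryTheory CategoryTheory.Limits

universe v u

/-- A (Barr-)exact category: finitely complete, with (regular epi, mono)-factorisations, with
pullback-stable regular epimorphisms, and in which every internal equivalence relation is the
kernel pair of some morphism. (Uniqueness of the factorisation up to isomorphism is automatic.) -/
class BarrExact (C : Type u) [Category.{v} C] : Prop extends HasFiniteLimits C where
  exists_factorisation : ∀ {A B : C} (f : A ⟶ B),
    ∃ (I : C) (p : A ⟶ I) (i : I ⟶ B), IsRegularEpi p ∧ Mono i ∧ p ≫ i = f
  regularEpi_stable : (MorphismProperty.regularEpi C).IsStableUnderBaseChange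
  effective : ∀ {R X : C} (r₁ r₂ : R ⟶ X), IsEquivalenceRelation r₁ r₂ →
    ∃ (Y : C) (f : X ⟶ Y), IsKernelPair f r₁ r₂

/-! ### Ideals of morphisms, relative exactness, pretorsion theories -/

namespace Pretorsion

variable {A : Type u} [Category.{v} A]

/-- The ideal of the morphisms that factor through an object of `Z`. -/
def nullIdeal (Z : ObjectProperty A) : MorphismProperty A := fun X Y f =>
  ∃ (W : A) (_ : Z W) (a : X ⟶ W) (b : W ⟶ Y), a ≫ b = f

/-- `k` is an `N`-kernel of `f`. -/
def IsNKernel (N : MorphismProperty A) {K X Y : A} (k : K ⟶ X) (f : X ⟶ Y) : Prop :=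
  N (k ≫ f) ∧ ∀ (W : A) (l : W ⟶ X), N (l ≫ f) → ∃! l' : W ⟶ K, l' ≫ k = l

/-- `c` is an `N`-cokernel of `f`. -/
def IsNCokernel (N : MorphismProperty A) {X Y Q : A} (c : Y ⟶ Q) (f : X ⟶ Y) : Prop :=
  N (f ≫ c) ∧ ∀ (W : A) (l : Y ⟶ W), N (f ≫ l) → ∃! l' : Q ⟶ W, c ≫ l' = l

/-- `X ⟶ Y ⟶ Z` is a short `N`-exact sequence. -/
def IsShortNExact (N : MorphismProperty A) {X Y Z : A} (f : X ⟶ Y) (g : Y ⟶ Z) : Prop :=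
  IsNKernel N f g ∧ IsNCokernel N g f

/-- `(T, F)` is a pretorsion theory. `T` and `F` are full replete subcategories, given by their
objects; the trivial objects are those of `T ⊓ F`. -/
structure IsPretorsionTheory (T F : ObjectProperty A) : Prop where
  torsion_replete : T.IsClosedUnderIsomorphisms
  torsionFree_replete : F.IsClosedUnderIsomorphisms
  trivial_nonempty : ∃ Z : A, (T ⊓ F) Z
  hom_null : ∀ (X Y : A) (f : X ⟶ Y), T X → F Y → nullIdeal (T ⊓ F) f
  exists_shortExact : ∀ X : A, ∃ (TX FX : A) (k : TX ⟶ X) (p : X ⟶ FX),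
    T TX ∧ F FX ∧ IsShortNExact (nullIdeal (T ⊓ F)) k p

end Pretorsion

/-! ### Internal preorders -/

/-- The pair `r₁, r₂ : R ⟶ A` is a relation on `A` (jointly monic) that is reflexive and
transitive. -/
structure IsInternalPreorder {C : Type u} [Category.{v} C] {R A : C} (r₁ r₂ : R ⟶ A) : Prop where
  refl : Nonempty (ReflexiveRelation r₁ r₂)
  trans : Nonempty (TransitiveRelation r₁ r₂)

/-- An object `(A, ρ)` of `PreOrd(C)`. -/
structure PreOrd (C : Type u) [Category.{v} C] where
  carrier : C
  rel : C
  r₁ : rel ⟶ carrier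
  r₂ : rel ⟶ carrier
  isPreorder : IsInternalPreorder r₁ r₂

namespace PreOrd

section Category

variable {C : Type u} [Category.{v} C]

/-- A morphism `(A, ρ) ⟶ (B, σ)`: a pair of compatible morphisms `A ⟶ B` and `ρ ⟶ σ`. -/
@[ext]
structure Hom (X Y : PreOrd C) where
  base : X.carrier ⟶ Y.carrier
  top : X.rel ⟶ Y.rel
  comm₁ : top ≫ Y.r₁ = X.r₁ ≫ base
  comm₂ : top ≫ Y.r₂ = X.r₂ ≫ base

instance : Category (PreOrd C) where
  Hom := Hom
  id X := ⟨𝟙 _, 𝟙 _, by simp, by simp⟩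
  comp f g := ⟨f.base ≫ g.base, f.top ≫ g.top,
    by simp [g.comm₁, reassoc_of% f.comm₁], by simp [g.comm₂, reassoc_of% f.comm₂]⟩

lemma jointlyMono (X : PreOrd C) : JointlyMono₂ X.r₁ X.r₂ :=
  X.isPreorder.refl.some.toJointlyMono₂

/-- The discrete relation `⟨1, 1⟩ : A ⟶ A × A` on `A`. -/
def discrete (A : C) : PreOrd C where
  carrier := A
  rel := A
  r₁ := 𝟙 A
  r₂ := 𝟙 A
  isPreorder :=
    { refl := ⟨{ right_cancellation := fun _ f g h _ => by simpa using h, r := 𝟙 A }⟩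
      trans := ⟨{ right_cancellation := fun _ f g h _ => by simpa using h
                  c := PullbackCone.mk (𝟙 A) (𝟙 A) rfl
                  isLimit := PullbackCone.isLimitMkIdId (𝟙 A)
                  t := 𝟙 A }⟩ }

lemma exists_trans (X : PreOrd C) {W : C} (a b : W ⟶ X.rel) (h : a ≫ X.r₂ = b ≫ X.r₁) :
    ∃ t : W ⟶ X.rel, t ≫ X.r₁ = a ≫ X.r₁ ∧ t ≫ X.r₂ = b ≫ X.r₂ := by
  obtain ⟨e⟩ := X.isPreorder.trans
  refine ⟨PullbackCone.IsLimit.lift e.isLimit a b h ≫ e.t, ?_, ?_⟩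
  · rw [Category.assoc, e.transitivity₁, ← Category.assoc, PullbackCone.IsLimit.lift_fst]
  · rw [Category.assoc, e.transitivity₂, ← Category.assoc, PullbackCone.IsLimit.lift_snd]

end Category

variable {C : Type u} [Category.{v} C] [HasFiniteLimits C]

instance mono_lift (X : PreOrd C) : Mono (prod.lift X.r₁ X.r₂) where
  right_cancellation f g h := X.jointlyMono.right_cancellation f g
    (by simpa only [Category.assoc, prod.lift_fst] using congrArg (fun k => k ≫ prod.fst) h)
    (by simpa only [Category.assoc, prod.lift_snd] using congrArg (fun k => k ≫ prod.snd) h)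

/-- The relation `ρ` as a subobject of `A × A`. -/
noncomputable def toSubobject (X : PreOrd C) : Subobject (X.carrier ⨯ X.carrier) :=
  Subobject.mk (prod.lift X.r₁ X.r₂)

/-- The object part of `∼ρ = ρ ∧ ρᵒ`: the pullback of `⟨r₁, r₂⟩` and `⟨r₂, r₁⟩`. -/
noncomputable abbrev simObj (X : PreOrd C) : C :=
  pullback (prod.lift X.r₁ X.r₂) (prod.lift X.r₂ X.r₁)

/-- The inclusion `∼ρ ⟶ ρ`. -/
noncomputable abbrev simIncl (X : PreOrd C) : X.simObj ⟶ X.rel :=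
  pullback.fst (prod.lift X.r₁ X.r₂) (prod.lift X.r₂ X.r₁)

/-- The two projections of the relation `∼ρ` on `A`. -/
noncomputable abbrev p₁ (X : PreOrd C) : X.simObj ⟶ X.carrier := X.simIncl ≫ X.r₁

/-- The second projection of `∼ρ`. -/
noncomputable abbrev p₂ (X : PreOrd C) : X.simObj ⟶ X.carrier := X.simIncl ≫ X.r₂

lemma simSnd_r₁ (X : PreOrd C) :
    pullback.snd (prod.lift X.r₁ X.r₂) (prod.lift X.r₂ X.r₁) ≫ X.r₁ = X.p₂ := by
  have h := congrArg (fun k => k ≫ prod.snd)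
    (pullback.condition (f := prod.lift X.r₁ X.r₂) (g := prod.lift X.r₂ X.r₁))
  simpa only [Category.assoc, prod.lift_snd] using h.symm

lemma simSnd_r₂ (X : PreOrd C) :
    pullback.snd (prod.lift X.r₁ X.r₂) (prod.lift X.r₂ X.r₁) ≫ X.r₂ = X.p₁ := by
  have h := congrArg (fun k => k ≫ prod.fst)
    (pullback.condition (f := prod.lift X.r₁ X.r₂) (g := prod.lift X.r₂ X.r₁))
  simpa only [Category.assoc, prod.lift_fst] using h.symm

lemma sim_jointlyMono (X : PreOrd C) : JointlyMono₂ X.p₁ X.p₂ where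
  right_cancellation W f g h₁ h₂ := by
    apply pullback.hom_ext
    · exact X.jointlyMono.right_cancellation _ _ (by simpa using h₁) (by simpa using h₂)
    · exact X.jointlyMono.right_cancellation _ _ (by simpa [simSnd_r₁] using h₂)
        (by simpa [simSnd_r₂] using h₁)

/-- A map into `∼ρ` from a pair of maps into `ρ` and `ρᵒ`. -/
lemma exists_sim_lift (X : PreOrd C) {W : C} (a b : W ⟶ X.rel)
    (h₁ : a ≫ X.r₁ = b ≫ X.r₂) (h₂ : a ≫ X.r₂ = b ≫ X.r₁) :
    ∃ t : W ⟶ X.simObj, t ≫ X.p₁ = a ≫ X.r₁ ∧ t ≫ X.p₂ = a ≫ X.r₂ := by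
  refine ⟨pullback.lift a b (by ext <;> simp [h₁, h₂]), ?_, ?_⟩ <;>
    rw [← Category.assoc, pullback.lift_fst]

lemma sim_isPreorder (X : PreOrd C) : IsInternalPreorder X.p₁ X.p₂ where
  refl := by
    obtain ⟨e⟩ := X.isPreorder.refl
    obtain ⟨t, h₁, h₂⟩ := X.exists_sim_lift e.r e.r (by simp) (by simp)
    exact ⟨{ X.sim_jointlyMono with
      r := t
      reflexivity₁ := by rw [h₁, e.reflexivity₁]
      reflexivity₂ := by rw [h₂, e.reflexivity₂] }⟩
  trans := by
    let a := pullback.fst X.p₂ X.p₁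
    let b := pullback.snd X.p₂ X.p₁
    let s := pullback.snd (prod.lift X.r₁ X.r₂) (prod.lift X.r₂ X.r₁)
    have hab : a ≫ X.p₂ = b ≫ X.p₁ := pullback.condition
    obtain ⟨t, ht₁, ht₂⟩ := X.exists_trans (a ≫ X.simIncl) (b ≫ X.simIncl) (by simpa using hab)
    obtain ⟨t', ht'₁, ht'₂⟩ := X.exists_trans (b ≫ s) (a ≫ s)
      (by simp only [Category.assoc, s, simSnd_r₁, simSnd_r₂]; exact hab.symm)
    simp only [Category.assoc, s, simSnd_r₁, simSnd_r₂] at ht₁ ht₂ ht'₁ ht'₂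
    obtain ⟨w, hw₁, hw₂⟩ := X.exists_sim_lift t t' (by rw [ht₁, ht'₂]) (by rw [ht₂, ht'₁])
    exact ⟨{ X.sim_jointlyMono with
      c := pullback.cone X.p₂ X.p₁
      isLimit := pullback.isLimit X.p₂ X.p₁
      t := w
      transitivity₁ := by rw [hw₁, ht₁]; rfl
      transitivity₂ := by rw [hw₂, ht₂]; rfl }⟩

/-- The object `(A, ∼ρ)` of `PreOrd(C)`. -/
noncomputable def sim (X : PreOrd C) : PreOrd C where
  carrier := X.carrier
  rel := X.simObj
  r₁ := X.p₁
  r₂ := X.p₂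
  isPreorder := X.sim_isPreorder

/-- The morphism `(1_A, i) : (A, ∼ρ) ⟶ (A, ρ)`. -/
noncomputable def simι (X : PreOrd C) : X.sim ⟶ X where
  base := 𝟙 X.carrier
  top := X.simIncl
  comm₁ := (Category.comp_id _).symm
  comm₂ := (Category.comp_id _).symm

variable (C)

/-- `Eq(C)`: the internal equivalence relations, i.e. the symmetric preorders. -/
def isEq : ObjectProperty (PreOrd C) := fun X => Nonempty (SymmetricRelation X.r₁ X.r₂)

/-- `ParOrd(C)`: the internal partial orders, i.e. the preorders with `ρ ∧ ρᵒ = Δ_A` as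
subobjects of `A × A`. -/
def isParOrd : ObjectProperty (PreOrd C) := fun X =>
  X.sim.toSubobject = (discrete X.carrier).toSubobject

/-- `Dis(C)`: the discrete relations, i.e. the preorders with `ρ = Δ_A` as subobjects of
`A × A`. -/
def isDis : ObjectProperty (PreOrd C) := fun X =>
  X.toSubobject = (discrete X.carrier).toSubobject

variable {C}

/-- A presentation of the canonical quotient of `(A, ρ)`: a coequalizer `π : A ⟶ A/∼ρ` of the two
projections of `∼ρ`, and the regular image `π(ρ)` of `ρ` along `π`, that is, a factorisation of
`⟨π r₁, π r₂⟩ : ρ ⟶ A/∼ρ × A/∼ρ` as a regular epimorphism `πbar : ρ ⟶ π(ρ)` followed by a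
relation `⟨s₁, s₂⟩`. -/
structure CanonicalQuotient (X : PreOrd C) where
  quot : C
  π : X.carrier ⟶ quot
  condition : X.p₁ ≫ π = X.p₂ ≫ π
  isCoequalizer : Nonempty (IsColimit (Cofork.ofπ π condition))
  image : C
  s₁ : image ⟶ quot
  s₂ : image ⟶ quot
  jointlyMono : JointlyMono₂ s₁ s₂
  πbar : X.rel ⟶ image
  regularEpi : IsRegularEpi πbar
  comm₁ : πbar ≫ s₁ = X.r₁ ≫ π
  comm₂ : πbar ≫ s₂ = X.r₂ ≫ π

namespace CanonicalQuotient

variable {X : PreOrd C} (q : X.CanonicalQuotient)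

/-- The object `(A/∼ρ, π(ρ))`, once `π(ρ)` is known to be reflexive and transitive. -/
def obj (h : IsInternalPreorder q.s₁ q.s₂) : PreOrd C where
  carrier := q.quot
  rel := q.image
  r₁ := q.s₁
  r₂ := q.s₂
  isPreorder := h

/-- The morphism `(π, πbar) : (A, ρ) ⟶ (A/∼ρ, π(ρ))`. -/
def proj (h : IsInternalPreorder q.s₁ q.s₂) : X ⟶ q.obj h where
  base := q.π
  top := q.πbar
  comm₁ := q.comm₁
  comm₂ := q.comm₂

end CanonicalQuotient

end PreOrd

/-! A morphism is null exactly when its base equalizes the two projections of its source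
(`nullIdeal_isDis_iff`), so relative exactness reduces to equations in `C`. By exactness `∼ρ` is a
kernel pair, hence the kernel pair of its coequalizer `π`. A map `l` into `(A, ρ)` is therefore
killed by the quotient exactly when it carries its source relation into `∼ρ`, which is the kernel
property. The cokernel property is the universal property of `π`, with the relation part descending
along the regular epimorphism onto `π(ρ)`. Transitivity and antisymmetry of `π(ρ)` are checked on
covers: pairs in `π(ρ)` lift to `ρ`, and lifts composable only up to `∼ρ` still compose because `∼ρ
≤ ρ`. -/

/-- Maps into a relation descend along strong epimorphisms. -/
lemma CategoryTheory.JointlyMono₂.exists_descent {C : Type u} [Category.{v} C] [HasFiniteLimits C]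
    {I Q₁ Q₂ V W : C} {s₁ : I ⟶ Q₁} {s₂ : I ⟶ Q₂} (hs : JointlyMono₂ s₁ s₂) (e : V ⟶ W)
    [StrongEpi e] {a : W ⟶ Q₁} {b : W ⟶ Q₂} (t : V ⟶ I) (h₁ : t ≫ s₁ = e ≫ a)
    (h₂ : t ≫ s₂ = e ≫ b) : ∃ u : W ⟶ I, u ≫ s₁ = a ∧ u ≫ s₂ = b ∧ e ≫ u = t := by
  have : Mono (prod.lift s₁ s₂) :=
    ⟨fun f g h => hs.right_cancellation f g
      (by simpa only [Category.assoc, prod.lift_fst] using congrArg (fun k => k ≫ prod.fst) h)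
      (by simpa only [Category.assoc, prod.lift_snd] using congrArg (fun k => k ≫ prod.snd) h)⟩
  have sq : CommSq t e (prod.lift s₁ s₂) (prod.lift a b) := ⟨by ext <;> simp [h₁, h₂]⟩
  refine ⟨sq.lift, ?_, ?_, sq.fac_left⟩
  · simpa only [Category.assoc, prod.lift_fst] using congrArg (fun k => k ≫ prod.fst) sq.fac_right
  · simpa only [Category.assoc, prod.lift_snd] using congrArg (fun k => k ≫ prod.snd) sq.fac_right

/-! ### Lifting generalized elements along regular epimorphisms -/

namespace BarrExact

variable {C : Type u} [Category.{v} C] [BarrExact C]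

/-- A generalized element of the codomain of a regular epimorphism lifts to its domain on a
regular epimorphic cover. -/
lemma exists_cover {X Y W : C} (p : X ⟶ Y) (hp : IsRegularEpi p) (a : W ⟶ Y) :
    ∃ (V : C) (e : V ⟶ W) (x : V ⟶ X), StrongEpi e ∧ x ≫ p = e ≫ a := by
  have := BarrExact.regularEpi_stable (C := C)
  have h : MorphismProperty.regularEpi C (pullback.snd p a) :=
    MorphismProperty.pullback_snd p a hp
  have : IsRegularEpi (pullback.snd p a) := h
  exact ⟨_, pullback.snd p a, pullback.fst p a, inferInstance, pullback.condition⟩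

/-- Two generalized elements lift along a regular epimorphism on a common cover. -/
lemma exists_cover₂ {X Y W : C} (p : X ⟶ Y) (hp : IsRegularEpi p) (a b : W ⟶ Y) :
    ∃ (V : C) (e : V ⟶ W) (x y : V ⟶ X), StrongEpi e ∧ x ≫ p = e ≫ a ∧ y ≫ p = e ≫ b := by
  obtain ⟨V, e, x, he, hx⟩ := exists_cover p hp a
  obtain ⟨V', e', y, he', hy⟩ := exists_cover p hp (e ≫ b)
  exact ⟨V', e' ≫ e, e' ≫ x, y, strongEpi_comp _ _, by simp [hx], by simp [hy]⟩

end BarrExact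

namespace PreOrd

open Pretorsion

/-! ### Morphisms of preorders and their bases -/

section Category

variable {C : Type u} [Category.{v} C]

@[simp] lemma comp_base {X Y Z : PreOrd C} (f : X ⟶ Y) (g : Y ⟶ Z) :
    (f ≫ g).base = f.base ≫ g.base := rfl

@[simp] lemma id_base (X : PreOrd C) : Hom.base (𝟙 X) = 𝟙 X.carrier := rfl

/-- A morphism of preorders is determined by its underlying morphism. -/
lemma hom_ext_base {X Y : PreOrd C} {f g : X ⟶ Y} (h : f.base = g.base) : f = g :=
  Hom.ext h (Y.jointlyMono.right_cancellation _ _ (by rw [f.comm₁, g.comm₁, h])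
    (by rw [f.comm₂, g.comm₂, h]))

lemma exists_refl (X : PreOrd C) : ∃ r : X.carrier ⟶ X.rel, r ≫ X.r₁ = 𝟙 _ ∧ r ≫ X.r₂ = 𝟙 _ :=
  let ⟨e⟩ := X.isPreorder.refl
  ⟨e.r, e.reflexivity₁, e.reflexivity₂⟩

/-- A morphism that identifies related elements factors through a discrete relation. -/
lemma exists_fac_discrete {X Y : PreOrd C} (f : X ⟶ Y) (h : X.r₁ ≫ f.base = X.r₂ ≫ f.base) :
    ∃ (a : X ⟶ discrete Y.carrier) (b : discrete Y.carrier ⟶ Y), a ≫ b = f := by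
  obtain ⟨r, hr₁, hr₂⟩ := Y.exists_refl
  let a : X ⟶ discrete Y.carrier := ⟨f.base, X.r₁ ≫ f.base, Category.comp_id _,
    (Category.comp_id _).trans h⟩
  let b : discrete Y.carrier ⟶ Y := ⟨𝟙 _, r, hr₁.trans (Category.comp_id _).symm,
    hr₂.trans (Category.comp_id _).symm⟩
  exact ⟨a, b, hom_ext_base (Category.comp_id _)⟩

end Category

/-! ### Discrete relations, partial orders and null morphisms -/

section FiniteLimits

variable {C : Type u} [Category.{v} C] [HasFiniteLimits C]

/-- If the projections agree, the reflexivity map is inverse to `r₁`, so `ρ` is the diagonal. -/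
lemma toSubobject_eq_discrete_iff (X : PreOrd C) :
    X.toSubobject = (discrete X.carrier).toSubobject ↔ X.r₁ = X.r₂ := by
  change Subobject.mk (prod.lift X.r₁ X.r₂) = Subobject.mk (diag X.carrier) ↔ X.r₁ = X.r₂
  constructor
  · intro h
    have w := Subobject.ofMkLEMk_comp h.le
    have w₁ := congrArg (fun k => k ≫ prod.fst) w
    have w₂ := congrArg (fun k => k ≫ prod.snd) w
    simp only [Category.assoc, prod.lift_fst, prod.lift_snd] at w₁ w₂
    exact w₁.symm.trans w₂
  · intro h
    obtain ⟨r, hr₁, hr₂⟩ := X.exists_refl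
    refine Subobject.mk_eq_mk_of_comm _ _ ⟨X.r₁, r, ?_, hr₁⟩ ?_
    · exact X.jointlyMono.right_cancellation _ _ (by simp [hr₁]) (by simp [hr₂, h])
    · ext <;> simp [h]

lemma isDis_iff (X : PreOrd C) : isDis C X ↔ X.r₁ = X.r₂ := X.toSubobject_eq_discrete_iff

lemma isParOrd_iff (X : PreOrd C) : isParOrd C X ↔ X.p₁ = X.p₂ :=
  X.sim.toSubobject_eq_discrete_iff

/-- Antisymmetry, for generalized elements. -/
lemma isParOrd_iff_forall (X : PreOrd C) : isParOrd C X ↔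
    ∀ (W : C) (a b : W ⟶ X.rel), a ≫ X.r₁ = b ≫ X.r₂ → a ≫ X.r₂ = b ≫ X.r₁ →
      a ≫ X.r₁ = a ≫ X.r₂ := by
  rw [isParOrd_iff]
  constructor
  · intro h W a b h₁ h₂
    obtain ⟨t, ht₁, ht₂⟩ := X.exists_sim_lift a b h₁ h₂
    rw [← ht₁, ← ht₂, h]
  · intro h
    exact h _ X.simIncl (pullback.snd _ _) X.simSnd_r₂.symm X.simSnd_r₁.symm

lemma discrete_isDis (A : C) : isDis C (discrete A) := (isDis_iff _).2 rfl

/-- The projections of a discrete relation agree, which gives one direction. Conversely, the base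
lands in the discrete relation on `Y.carrier`, which maps to `Y` by reflexivity. -/
lemma nullIdeal_isDis_iff {X Y : PreOrd C} (f : X ⟶ Y) :
    nullIdeal (isDis C) f ↔ X.r₁ ≫ f.base = X.r₂ ≫ f.base := by
  constructor
  · rintro ⟨W, hW, a, b, rfl⟩
    rw [isDis_iff] at hW
    rw [comp_base, ← Category.assoc, ← Category.assoc, ← a.comm₁, ← a.comm₂, hW]
  · intro h
    obtain ⟨a, b, hab⟩ := exists_fac_discrete f h
    exact ⟨_, discrete_isDis _, a, b, hab⟩

lemma sim_isEq (X : PreOrd C) : isEq C X.sim := by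
  obtain ⟨s, h₁, h₂⟩ := X.exists_sim_lift (pullback.snd _ _) X.simIncl X.simSnd_r₁ X.simSnd_r₂
  exact ⟨{ X.sim_jointlyMono with
    s := s
    symmetry₁ := h₁.trans X.simSnd_r₁
    symmetry₂ := h₂.trans X.simSnd_r₂ }⟩

/-- A morphism from an equivalence relation to a partial order identifies related elements. -/
lemma r₁_comp_base_eq {X Y : PreOrd C} (f : X ⟶ Y) (hX : isEq C X) (hY : isParOrd C Y) :
    X.r₁ ≫ f.base = X.r₂ ≫ f.base := by
  obtain ⟨e⟩ := hX
  rw [← f.comm₁, ← f.comm₂]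
  refine (isParOrd_iff_forall Y).1 hY _ f.top (e.s ≫ f.top) ?_ ?_
  · rw [Category.assoc, f.comm₁, f.comm₂, e.symmetry₂_assoc]
  · rw [Category.assoc, f.comm₁, f.comm₂, e.symmetry₁_assoc]

lemma isEq_inf_isParOrd : isEq C ⊓ isParOrd C = isDis C := by
  ext X
  rw [isDis_iff]
  constructor
  · rintro ⟨hE, hP⟩
    -- The identity is here a morphism from an equivalence relation to a partial order.
    simpa using r₁_comp_base_eq (𝟙 X) hE hP
  · intro h
    refine ⟨⟨{ X.jointlyMono with s := 𝟙 _, symmetry₁ := ?_, symmetry₂ := ?_ }⟩, ?_⟩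
    · simpa using h
    · simpa using h.symm
    · rw [isParOrd_iff, p₁, p₂, h]

instance : (isEq C).IsClosedUnderIsomorphisms where
  of_iso {X Y} e := by
    rintro ⟨s⟩
    have hb : e.inv.base ≫ e.hom.base = 𝟙 _ := by rw [← comp_base, e.inv_hom_id, id_base]
    refine ⟨{ Y.jointlyMono with
      s := e.inv.top ≫ s.s ≫ e.hom.top
      symmetry₁ := ?_
      symmetry₂ := ?_ }⟩
    · rw [Category.assoc, Category.assoc, e.hom.comm₁, s.symmetry₁_assoc, ← Category.assoc,
        e.inv.comm₂, Category.assoc, hb, Category.comp_id]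
    · rw [Category.assoc, Category.assoc, e.hom.comm₂, s.symmetry₂_assoc, ← Category.assoc,
        e.inv.comm₁, Category.assoc, hb, Category.comp_id]

instance : (isParOrd C).IsClosedUnderIsomorphisms where
  of_iso {X Y} e hX := by
    rw [isParOrd_iff_forall] at hX ⊢
    intro W a b h₁ h₂
    have hb : e.inv.base ≫ e.hom.base = 𝟙 _ := by rw [← comp_base, e.inv_hom_id, id_base]
    have h := hX W (a ≫ e.inv.top) (b ≫ e.inv.top)
      (by simp only [Category.assoc, e.inv.comm₁, e.inv.comm₂, reassoc_of% h₁])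
      (by simp only [Category.assoc, e.inv.comm₁, e.inv.comm₂, reassoc_of% h₂])
    simp only [Category.assoc, e.inv.comm₁, e.inv.comm₂] at h
    simpa [hb] using congrArg (fun k => k ≫ e.hom.base) h

end FiniteLimits

/-! ### The canonical quotient and its exact sequence -/

section Exact

variable {C : Type u} [Category.{v} C] [BarrExact C]

/-- `∼ρ` is the kernel pair of some morphism. -/
lemma exists_isKernelPair_sim (X : PreOrd C) :
    ∃ (Y : C) (f : X.carrier ⟶ Y), IsKernelPair f X.p₁ X.p₂ := by
  obtain ⟨r⟩ := X.sim_isPreorder.refl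
  obtain ⟨t⟩ := X.sim_isPreorder.trans
  obtain ⟨s⟩ := X.sim_isEq
  exact BarrExact.effective _ _ ⟨⟨{ r, s, t with }⟩⟩

lemma nonempty_canonicalQuotient (X : PreOrd C) : Nonempty X.CanonicalQuotient := by
  obtain ⟨Y, f, hf⟩ := X.exists_isKernelPair_sim
  obtain ⟨Q, π, i, hπ, hi, rfl⟩ := BarrExact.exists_factorisation f
  -- Dropping the monic factor keeps the kernel pair, and a regular epimorphism is the coequalizer
  -- of its kernel pair.
  have hk : IsKernelPair π X.p₁ X.p₂ := hf.cancel_right_of_mono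
  obtain ⟨I, e, m, he, hm, hem⟩ :=
    BarrExact.exists_factorisation (prod.lift (X.r₁ ≫ π) (X.r₂ ≫ π))
  exact ⟨{
    quot := Q
    π := π
    condition := hk.w
    isCoequalizer := ⟨hk.toCoequalizer'⟩
    image := I
    s₁ := m ≫ prod.fst
    s₂ := m ≫ prod.snd
    jointlyMono := ⟨fun W a b h₁ h₂ => by
      rw [← cancel_mono m]
      ext <;> simpa⟩
    πbar := e
    regularEpi := he
    comm₁ := by rw [reassoc_of% hem, prod.lift_fst]
    comm₂ := by rw [reassoc_of% hem, prod.lift_snd] }⟩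

namespace CanonicalQuotient

variable {X : PreOrd C} (q : X.CanonicalQuotient)

lemma exists_desc {W : C} (k : X.carrier ⟶ W) (h : X.p₁ ≫ k = X.p₂ ≫ k) :
    ∃ l : q.quot ⟶ W, q.π ≫ l = k :=
  let ⟨l, hl⟩ := Cofork.IsColimit.desc' q.isCoequalizer.some k h
  ⟨l, hl⟩

lemma epi_π : Epi q.π := q.isCoequalizer.elim fun h => Cofork.IsColimit.epi h

/-- Some `f` has kernel pair `∼ρ` and factors through the coequalizer `π`, so whatever `π`
identifies `f` identifies too. -/
lemma exists_sim_of_comp_π_eq {W : C} (a b : W ⟶ X.carrier) (h : a ≫ q.π = b ≫ q.π) :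
    ∃ t : W ⟶ X.simObj, t ≫ X.p₁ = a ∧ t ≫ X.p₂ = b := by
  obtain ⟨Y, f, hf⟩ := X.exists_isKernelPair_sim
  obtain ⟨g, rfl⟩ := q.exists_desc f hf.w
  exact ⟨hf.lift a b (by rw [reassoc_of% h]), hf.lift_fst _ _ _, hf.lift_snd _ _ _⟩

lemma exists_rel_of_comp_π_eq {W : C} (a b : W ⟶ X.carrier) (h : a ≫ q.π = b ≫ q.π) :
    ∃ t : W ⟶ X.rel, t ≫ X.r₁ = a ∧ t ≫ X.r₂ = b := by
  obtain ⟨t, h₁, h₂⟩ := q.exists_sim_of_comp_π_eq a b h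
  exact ⟨t ≫ X.simIncl, by simpa using h₁, by simpa using h₂⟩

lemma comp_π_eq_of_rel {W : C} (a b : W ⟶ X.rel) (h₁ : a ≫ X.r₁ = b ≫ X.r₂)
    (h₂ : a ≫ X.r₂ = b ≫ X.r₁) : a ≫ X.r₁ ≫ q.π = a ≫ X.r₂ ≫ q.π := by
  obtain ⟨t, ht₁, ht₂⟩ := X.exists_sim_lift a b h₁ h₂
  rw [← Category.assoc, ← Category.assoc, ← ht₁, ← ht₂, Category.assoc t X.p₁,
    Category.assoc t X.p₂, q.condition]

/-- Composition of elements of `ρ` that are composable up to `∼ρ`. -/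
lemma exists_trans {W : C} (a b : W ⟶ X.rel) (h : a ≫ X.r₂ ≫ q.π = b ≫ X.r₁ ≫ q.π) :
    ∃ t : W ⟶ X.rel, t ≫ X.r₁ = a ≫ X.r₁ ∧ t ≫ X.r₂ = b ≫ X.r₂ := by
  obtain ⟨m, hm₁, hm₂⟩ := q.exists_rel_of_comp_π_eq (a ≫ X.r₂) (b ≫ X.r₁) (by simpa using h)
  obtain ⟨u, hu₁, hu₂⟩ := X.exists_trans a m hm₁.symm
  obtain ⟨w, hw₁, hw₂⟩ := X.exists_trans u b (hu₂.trans hm₂)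
  exact ⟨w, hw₁.trans hu₁, hw₂⟩

lemma isInternalPreorder : IsInternalPreorder q.s₁ q.s₂ where
  refl := by
    obtain ⟨r, hr₁, hr₂⟩ := X.exists_refl
    have h₁ : (r ≫ q.πbar) ≫ q.s₁ = q.π := by rw [Category.assoc, q.comm₁, reassoc_of% hr₁]
    have h₂ : (r ≫ q.πbar) ≫ q.s₂ = q.π := by rw [Category.assoc, q.comm₂, reassoc_of% hr₂]
    -- The reflexivity of `π(ρ)` is that of `ρ` descended along `π`; joint monicity shows that it
    -- respects `∼ρ`.
    obtain ⟨l, hl⟩ := q.exists_desc (r ≫ q.πbar) (q.jointlyMono.right_cancellation _ _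
      (by rw [Category.assoc X.p₁, Category.assoc X.p₂, h₁, q.condition])
      (by rw [Category.assoc X.p₁, Category.assoc X.p₂, h₂, q.condition]))
    have := q.epi_π
    exact ⟨{ q.jointlyMono with
      r := l
      reflexivity₁ := by rw [← cancel_epi q.π, reassoc_of% hl, ← Category.assoc, h₁]; simp
      reflexivity₂ := by rw [← cancel_epi q.π, reassoc_of% hl, ← Category.assoc, h₂]; simp }⟩
  trans := by
    obtain ⟨V, e, x, y, he, hx, hy⟩ := BarrExact.exists_cover₂ q.πbar q.regularEpi
      (pullback.fst q.s₂ q.s₁) (pullback.snd q.s₂ q.s₁)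
    obtain ⟨z, hz₁, hz₂⟩ := q.exists_trans x y (by
      rw [← q.comm₁, ← q.comm₂, reassoc_of% hx, reassoc_of% hy, pullback.condition])
    obtain ⟨t, ht₁, ht₂, -⟩ := q.jointlyMono.exists_descent e
      (a := pullback.fst q.s₂ q.s₁ ≫ q.s₁) (b := pullback.snd q.s₂ q.s₁ ≫ q.s₂) (z ≫ q.πbar)
      (by rw [Category.assoc, q.comm₁, reassoc_of% hz₁, ← q.comm₁, reassoc_of% hx])
      (by rw [Category.assoc, q.comm₂, reassoc_of% hz₂, ← q.comm₂, reassoc_of% hy])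
    exact ⟨{ q.jointlyMono with
      c := pullback.cone q.s₂ q.s₁
      isLimit := pullback.isLimit q.s₂ q.s₁
      t := t
      transitivity₁ := ht₁
      transitivity₂ := ht₂ }⟩

lemma obj_isParOrd (h : IsInternalPreorder q.s₁ q.s₂) : isParOrd C (q.obj h) := by
  rw [isParOrd_iff_forall]
  intro W (a : W ⟶ q.image) (b : W ⟶ q.image) (h₁ : a ≫ q.s₁ = b ≫ q.s₂)
    (h₂ : a ≫ q.s₂ = b ≫ q.s₁)
  change a ≫ q.s₁ = a ≫ q.s₂
  obtain ⟨V, e, x, y, he, hx, hy⟩ := BarrExact.exists_cover₂ q.πbar q.regularEpi a b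
  have hxy : x ≫ X.r₂ ≫ q.π = y ≫ X.r₁ ≫ q.π := by
    rw [← q.comm₁, ← q.comm₂, reassoc_of% hx, reassoc_of% hy, h₂]
  have hyx : y ≫ X.r₂ ≫ q.π = x ≫ X.r₁ ≫ q.π := by
    rw [← q.comm₁, ← q.comm₂, reassoc_of% hx, reassoc_of% hy, h₁]
  obtain ⟨m, hm₁, hm₂⟩ := q.exists_rel_of_comp_π_eq (x ≫ X.r₂) (y ≫ X.r₁) (by simpa using hxy)
  obtain ⟨n, hn₁, hn₂⟩ := q.exists_rel_of_comp_π_eq (y ≫ X.r₂) (x ≫ X.r₁) (by simpa using hyx)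
  obtain ⟨u, hu₁, hu₂⟩ := X.exists_trans m y hm₂
  obtain ⟨w, hw₁, hw₂⟩ := X.exists_trans u n (hu₂.trans hn₁.symm)
  -- The chain `m`, `y`, `n` composes to `w`, which runs from the target of `x` back to its source.
  -- So the endpoints of `x` are `∼ρ`-related and `π` identifies them.
  have := q.comp_π_eq_of_rel x w (hw₂.trans hn₂).symm ((hw₁.trans hu₁).trans hm₁).symm
  rw [← cancel_epi e, ← reassoc_of% hx, ← reassoc_of% hx, q.comm₁, q.comm₂, this]

lemma isNKernel (h : IsInternalPreorder q.s₁ q.s₂) :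
    IsNKernel (nullIdeal (isDis C)) X.simι (q.proj h) := by
  refine ⟨(nullIdeal_isDis_iff _).2 ?_, fun W l hl => ?_⟩
  · change X.p₁ ≫ 𝟙 _ ≫ q.π = X.p₂ ≫ 𝟙 _ ≫ q.π
    rw [Category.id_comp, q.condition]
  · replace hl : W.r₁ ≫ l.base ≫ q.π = W.r₂ ≫ l.base ≫ q.π := (nullIdeal_isDis_iff _).1 hl
    obtain ⟨t, ht₁, ht₂⟩ := q.exists_sim_of_comp_π_eq (W.r₁ ≫ l.base) (W.r₂ ≫ l.base)
      (by simpa using hl)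
    -- The base of the inclusion is the identity, so the base of the factorisation must be that of
    -- `l`.
    let l' : W ⟶ X.sim := ⟨l.base, t, ht₁, ht₂⟩
    refine ⟨l', hom_ext_base (Category.comp_id _), fun m hm => hom_ext_base ?_⟩
    exact (Category.comp_id _).symm.trans (congrArg Hom.base hm)

lemma isNCokernel (h : IsInternalPreorder q.s₁ q.s₂) :
    IsNCokernel (nullIdeal (isDis C)) (q.proj h) X.simι := by
  refine ⟨(q.isNKernel h).1, fun W l hl => ?_⟩
  replace hl : X.p₁ ≫ 𝟙 _ ≫ l.base = X.p₂ ≫ 𝟙 _ ≫ l.base := (nullIdeal_isDis_iff _).1 hl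
  rw [Category.id_comp] at hl
  obtain ⟨g, hg⟩ := q.exists_desc l.base hl
  have := q.regularEpi
  -- Monotonicity of `g` holds after precomposing with `πbar`, and descends because `πbar` is a
  -- strong epimorphism.
  obtain ⟨u, hu₁, hu₂, -⟩ := W.jointlyMono.exists_descent q.πbar (a := q.s₁ ≫ g)
    (b := q.s₂ ≫ g) l.top (by rw [l.comm₁, reassoc_of% q.comm₁, hg])
    (by rw [l.comm₂, reassoc_of% q.comm₂, hg])
  let l' : q.obj h ⟶ W := ⟨g, u, hu₁, hu₂⟩
  have := q.epi_π
  refine ⟨l', hom_ext_base hg, fun m hm => hom_ext_base ?_⟩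
  exact (cancel_epi q.π).1 ((congrArg Hom.base hm).trans hg.symm)

lemma isShortNExact (h : IsInternalPreorder q.s₁ q.s₂) :
    IsShortNExact (nullIdeal (isDis C)) X.simι (q.proj h) :=
  ⟨q.isNKernel h, q.isNCokernel h⟩

end CanonicalQuotient

lemma isPretorsionTheory : IsPretorsionTheory (isEq C) (isParOrd C) where
  torsion_replete := inferInstance
  torsionFree_replete := inferInstance
  trivial_nonempty := ⟨discrete (⊤_ C), by rw [isEq_inf_isParOrd]; exact discrete_isDis _⟩
  hom_null X Y f hX hY := by
    rw [isEq_inf_isParOrd, nullIdeal_isDis_iff]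
    exact r₁_comp_base_eq f hX hY
  exists_shortExact X := by
    obtain ⟨q⟩ := X.nonempty_canonicalQuotient
    rw [isEq_inf_isParOrd]
    exact ⟨X.sim, q.obj q.isInternalPreorder, X.simι, q.proj _, X.sim_isEq, q.obj_isParOrd _,
      q.isShortNExact _⟩

end Exact

end PreOrd

theorem mainTheorem2 (C : Type u) [Category.{v} C] [BarrExact C] :
    Pretorsion.IsPretorsionTheory (PreOrd.isEq C) (PreOrd.isParOrd C) ∧
    PreOrd.isEq C ⊓ PreOrd.isParOrd C = PreOrd.isDis C ∧
    ∀ X : PreOrd C,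
      PreOrd.isEq C X.sim ∧
      Nonempty X.CanonicalQuotient ∧
      ∀ q : X.CanonicalQuotient, ∃ h : IsInternalPreorder q.s₁ q.s₂,
        PreOrd.isParOrd C (q.obj h) ∧
        Pretorsion.IsShortNExact (Pretorsion.nullIdeal (PreOrd.isDis C)) X.simι (q.proj h) :=
  ⟨PreOrd.isPretorsionTheory, PreOrd.isEq_inf_isParOrd, fun X =>
    ⟨X.sim_isEq, X.nonempty_canonicalQuotient, fun q =>
      ⟨q.isInternalPreorder, q.obj_isParOrd _, q.isShortNExact _⟩⟩⟩
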